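/- Let $d\ge 1$, let $\Omega\subset\mathbb R^d$ be a bounded open set, let $\rho\in C_c^\infty(\Omega)$ with $\rho\ge 0$, and let $f:L^2(\Omega)\to L^2(\Omega)$ be continuous and strictly monotone, i.e. $$\int_\Omega \big(f(m_1)-f(m_2)\big)(m_1-m_2)\,dx>0\qquad\text{for all } m_1,m_2\in L^2(\Omega)\text{ with } m_1\neq m_2 .$$ Consider the stationary system $$\max(-\Delta u+u-f(m),\,u)=0 \text{ in }\Omega,\qquad -\Delta m+m=\rho \text{ on }\{u<0\},\qquad m=0\text{ on }\{u=0\},\qquad u=m=0\text{ on }\partial\Omega .$$ A solution is a pair $(u,m)\in \big(H^2(\Omega)\cap H^1_0(\Omega)\big)\times H^1_0(\Omega)$ such that 1. $\max(-\Delta u+u-f(m),u)=0$ a.e. in $\Omega$; 2. $m\in H^1_0(\{u<0\})$, extended by $0$ to $\Omega$, and $\int_\Omega \nabla m\cdot\nabla\varphi+m\varphi\,dx=\int_\Omega\rho\,\varphi\,dx$ for all $\varphi\in H^1_0(\{u<0\})$. Here $H^1_0(\Omega)$ is the closure of $C_c^\infty(\Omega)$ in $H^1(\Omega)$, the set $\{u<0\}$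 is that of a quasi-continuous representative of $u$, and $H^1_0(\{u<0\})$ is the set of $v\in H^1_0(\Omega)$ that vanish quasi-everywhere on $\Omega\setminus\{u<0\}$ (in the sense of quasi-continuous representatives and of the $H^1$-capacity relative to $\Omega$); when $\{u<0\}$ is open, this is the closure of $C_c^\infty(\{u<0\})$ in $H^1(\Omega)$. Then the system has at most one solution: if $(u_1,m_1)$ and $(u_2,m_2)$ are solutions, then $u_1=u_2$ and $m_1=m_2$ (as elements of $L^2(\Omega)$). -/

import Mathlib

noncomputable section

namespace SOSMFG

open MeasureTheory Filter Topology
open scoped ENNReal ContDiff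

/-- The Euclidean space `ℝ^d`. -/
abbrev Space (d : ℕ) : Type := EuclideanSpace ℝ (Fin d)

/-- The real Hilbert space `L²(Ω)` (classes of functions modulo a.e. equality on `Ω`). -/
abbrev L2 {d : ℕ} (Ω : Set (Space d)) : Type :=
  Lp ℝ 2 ((volume : Measure (Space d)).restrict Ω)

/-- Smooth functions on `ℝ^d` with compact support contained in `Ω`. -/
def IsTest {d : ℕ} (Ω : Set (Space d)) (φ : Space d → ℝ) : Prop :=
  ContDiff ℝ ∞ φ ∧ HasCompactSupport φ ∧ tsupport φ ⊆ Ω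

/-- The classical partial derivative `∂ᵢ φ`. -/
def partialDeriv {d : ℕ} (i : Fin d) (φ : Space d → ℝ) (x : Space d) : ℝ :=
  fderiv ℝ φ x (EuclideanSpace.single i 1)

/-- `G = ∇v` in the sense of distributions on `Ω`, where `v` and all `G i` are in `L²(Ω)`. -/
def HasWeakGrad {d : ℕ} {Ω : Set (Space d)} (v : L2 Ω) (G : Fin d → L2 Ω) : Prop :=
  ∀ i : Fin d, ∀ φ : Space d → ℝ, IsTest Ω φ →
    ∫ x in Ω, v x * partialDeriv i φ x = - ∫ x in Ω, G i x * φ x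

/-- `v ∈ H¹₀(Ω)`: the closure of the test functions on `Ω` for the `H¹(Ω)` norm. -/
def MemH10 {d : ℕ} {Ω : Set (Space d)} (v : L2 Ω) : Prop :=
  ∃ G : Fin d → L2 Ω, HasWeakGrad v G ∧
    ∃ φ : ℕ → Space d → ℝ, (∀ n, IsTest Ω (φ n)) ∧
      Tendsto (fun n => eLpNorm (fun x => φ n x - v x) 2 (volume.restrict Ω)) atTop (𝓝 0) ∧
      ∀ i : Fin d, Tendsto
        (fun n => eLpNorm (fun x => partialDeriv i (φ n) x - G i x) 2 (volume.restrict Ω))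
        atTop (𝓝 0)

/-- The `H¹`-capacity of `A` relative to `Ω`: the infimum of `‖v‖² + ‖∇v‖²` over all
`v ∈ H¹₀(Ω)` with `v ≥ 1` a.e. on some open `U` with `A ⊆ U ⊆ Ω` (it is `∞` if there is none). -/
def capacity {d : ℕ} (Ω A : Set (Space d)) : ℝ≥0∞ :=
  sInf {c : ℝ≥0∞ | ∃ (U : Set (Space d)) (v : L2 Ω) (G : Fin d → L2 Ω),
    IsOpen U ∧ A ⊆ U ∧ U ⊆ Ω ∧ MemH10 v ∧ HasWeakGrad v G ∧
    (∀ᵐ x ∂(volume.restrict U), 1 ≤ v x) ∧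
    c = ‖v‖ₑ ^ 2 + ∑ i, ‖G i‖ₑ ^ 2}

/-- `g` is quasi-continuous on `Ω`: its restriction to the complement in `Ω` of some open set of
arbitrarily small capacity is continuous. -/
def QuasiContinuous {d : ℕ} (Ω : Set (Space d)) (g : Space d → ℝ) : Prop :=
  ∀ ε : ℝ≥0∞, 0 < ε → ∃ U : Set (Space d), IsOpen U ∧ U ⊆ Ω ∧ capacity Ω U < ε ∧
    ContinuousOn g (Ω \ U)

/-- `g` is a quasi-continuous representative of the class `v`. Every element of `H¹₀(Ω)` has one,
unique up to a set of capacity zero. -/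
def IsQuasiContRep {d : ℕ} {Ω : Set (Space d)} (g : Space d → ℝ) (v : L2 Ω) : Prop :=
  QuasiContinuous Ω g ∧ ∀ᵐ x ∂(volume.restrict Ω), g x = v x

/-- `v ∈ H¹₀(W)` (extended by zero), for `W ⊆ Ω` open or, more generally, quasi-open: `v ∈ H¹₀(Ω)`
and `v = 0` quasi-everywhere on `Ω \ W`. For open `W` this is the closure of the smooth functions
with compact support in `W` for the `H¹(Ω)` norm. -/
def MemH10On {d : ℕ} {Ω : Set (Space d)} (W : Set (Space d)) (v : L2 Ω) : Prop :=
  MemH10 v ∧ ∃ g : Space d → ℝ, IsQuasiContRep g v ∧ capacity Ω {x ∈ Ω \ W | g x ≠ 0} = 0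

/-- `u ∈ H²(Ω) ∩ H¹₀(Ω)` and `max(-Δu + u - g, u) = 0` a.e. in `Ω`. -/
def SolvesObstacle {d : ℕ} {Ω : Set (Space d)} (g u : L2 Ω) : Prop :=
  MemH10 u ∧ ∃ (G : Fin d → L2 Ω) (H : Fin d → Fin d → L2 Ω),
    HasWeakGrad u G ∧ (∀ i, HasWeakGrad (G i) (H i)) ∧
    ∀ᵐ x ∂(volume.restrict Ω), max (-(∑ i, H i i x) + u x - g x) (u x) = 0

/-- `m ∈ H¹₀(W)`, extended by zero outside `W`, solves `-Δm + m = ρ` in `W`: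
`∫ ∇m · ∇φ + ∫ m φ = ∫ ρ φ` for all `φ ∈ H¹₀(W)`. -/
def SolvesDirichlet {d : ℕ} {Ω : Set (Space d)} (ρ : Space d → ℝ) (W : Set (Space d))
    (m : L2 Ω) : Prop :=
  MemH10On W m ∧ ∀ φ : L2 Ω, MemH10On W φ →
    ∀ Gm Gφ : Fin d → L2 Ω, HasWeakGrad m Gm → HasWeakGrad φ Gφ →
      (∑ i, ∫ x in Ω, Gm i x * Gφ i x) + ∫ x in Ω, m x * φ x = ∫ x in Ω, ρ x * φ x

/-- `(u, m)` is a solution of the stationary optimal stopping mean field game system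
`max(-Δu + u - f(m), u) = 0` in `Ω`, `-Δm + m = ρ` on `{u < 0}`, `m = 0` on `{u = 0}`,
`u = m = 0` on `∂Ω`. The set `{u < 0}` is that of a quasi-continuous representative of `u`
(of the continuous one when `u` is continuous); its choice does not matter. -/
def IsSolution {d : ℕ} (Ω : Set (Space d)) (f : L2 Ω → L2 Ω) (ρ : Space d → ℝ)
    (u m : L2 Ω) : Prop :=
  SolvesObstacle (f m) u ∧
    ∃ u' : Space d → ℝ, IsQuasiContRep u' u ∧ SolvesDirichlet ρ {x ∈ Ω | u' x < 0} m

/-- Strict monotonicity of `T : L²(Ω) → L²(Ω)`. -/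
def StrictlyMonotone {d : ℕ} {Ω : Set (Space d)} (T : L2 Ω → L2 Ω) : Prop :=
  ∀ m₁ m₂ : L2 Ω, m₁ ≠ m₂ → 0 < ∫ x in Ω, (T m₁ x - T m₂ x) * (m₁ x - m₂ x)

end SOSMFG

end

/-!
The proof is the Lasry–Lions monotonicity argument, written with the energy form
`⟨v, w⟩ = ∫ v w + ∫ ∇v · ∇w` of the operator `-Δ + 1`.

Let `(u, m)` be a solution and put `A = -Δu + u`, so that `A ≤ f(m)`, with equality where `u < 0`.
Let `n` solve the Dirichlet problem `-Δn + n = ρ` in any other set. As `m` vanishes where `u = 0`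
and `n ≥ 0`, one has `(f(m) - A)(m - n) ≤ 0` a.e., hence
`∫ f(m)(m - n) ≤ ∫ A (m - n) = ⟨m, u⟩ - ⟨n, u⟩`. Here `⟨m, u⟩ = ∫ ρ u`, since `u` is an admissible
test function for `m`, and `⟨n, -u⟩ ≤ ∫ ρ (-u)`, since `-u ≥ 0` and `-Δn + n ≤ ρ` in the whole of
`Ω` (`SolvesDirichlet.energy_le`). So `∫ f(m)(m - n) ≤ 0` (`inner_sub_nonpos`). Applying this to
both solutions and adding contradicts strict monotonicity unless `m₁ = m₂`. Then `u₁` and `u₂`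
solve the same obstacle problem and coincide (`SolvesObstacle.unique`).

The inequality `-Δn + n ≤ ρ` against `φ ≥ 0` comes from the test function `min(n, tφ)` with `t → 0`.
It is admissible because `H¹₀(W)` is an order ideal (`MemH10On.comp₂`), which rests on two facts:
`H¹₀(Ω)` is stable under positive parts (`sobolevGraph_posPart`), and finite unions of sets of small
capacity have small capacity (`capacity_union_lt`). Because `φ = -u` has its Laplacian in `L²`, the
limit `t → 0` needs no more than convergence in `L²`.

`H¹₀(Ω)` is handled as the closed subspace `sobolevGraph Ω` of pairs `(v, ∇v)` in
`L²(Ω) × L²(Ω)^d`, so that identities such as Green's formula extend by density from test functions.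
-/

noncomputable section

namespace SOSMFG

open MeasureTheory Filter Topology
open scoped ENNReal ContDiff

/-! ### Test functions and weak gradients -/

section TestFunctions

variable {d : ℕ} {Ω : Set (Space d)} {φ ψ : Space d → ℝ}

lemma IsTest.add (hφ : IsTest Ω φ) (hψ : IsTest Ω ψ) : IsTest Ω (fun x => φ x + ψ x) :=
  ⟨hφ.1.add hψ.1, hφ.2.1.add hψ.2.1,
    (tsupport_add φ ψ).trans (Set.union_subset hφ.2.2 hψ.2.2)⟩

lemma IsTest.const_mul (hφ : IsTest Ω φ) (c : ℝ) : IsTest Ω (fun x => c * φ x) :=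
  ⟨contDiff_const.mul hφ.1, hφ.2.1.mul_left,
    (tsupport_mul_subset_right (f := fun _ => c) (g := φ)).trans hφ.2.2⟩

lemma isTest_zero : IsTest Ω (fun _ => 0) :=
  ⟨contDiff_const, HasCompactSupport.zero, by simp [tsupport]⟩

lemma IsTest.comp_left (hφ : IsTest Ω φ) {β : ℝ → ℝ} (hβ : ContDiff ℝ ∞ β) (h0 : β 0 = 0) :
    IsTest Ω (fun x => β (φ x)) :=
  ⟨hβ.comp hφ.1, hφ.2.1.comp_left h0,
    (closure_mono (Function.support_comp_subset h0 φ)).trans hφ.2.2⟩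

lemma IsTest.differentiable (hφ : IsTest Ω φ) : Differentiable ℝ φ :=
  hφ.1.differentiable (by simp)

lemma IsTest.partialDeriv (hφ : IsTest Ω φ) (i : Fin d) : IsTest Ω (partialDeriv i φ) := by
  refine ⟨(hφ.1.fderiv_right (m := ∞) (by simp)).clm_apply contDiff_const,
    hφ.2.1.fderiv_apply (𝕜 := ℝ) _, ?_⟩
  exact (tsupport_fderiv_apply_subset ℝ (f := φ) (EuclideanSpace.single i 1)).trans hφ.2.2

lemma IsTest.memLp (hφ : IsTest Ω φ) : MemLp φ 2 ((volume : Measure (Space d)).restrict Ω) :=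
  (hφ.1.continuous.memLp_of_hasCompactSupport hφ.2.1).restrict Ω

lemma partialDeriv_add (hφ : IsTest Ω φ) (hψ : IsTest Ω ψ) (i : Fin d) (x : Space d) :
    partialDeriv i (fun x => φ x + ψ x) x = partialDeriv i φ x + partialDeriv i ψ x := by
  simp only [SOSMFG.partialDeriv]
  rw [fderiv_fun_add (hφ.differentiable x) (hψ.differentiable x)]
  rfl

lemma partialDeriv_const_mul (hφ : IsTest Ω φ) (c : ℝ) (i : Fin d) (x : Space d) :
    partialDeriv i (fun x => c * φ x) x = c * partialDeriv i φ x := by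
  simp only [SOSMFG.partialDeriv]
  rw [fderiv_const_mul (hφ.differentiable x)]
  rfl

lemma partialDeriv_comp_left (hφ : IsTest Ω φ) {β : ℝ → ℝ} (hβ : Differentiable ℝ β) (i : Fin d)
    (x : Space d) :
    partialDeriv i (fun x => β (φ x)) x = deriv β (φ x) * partialDeriv i φ x := by
  have h := ((hβ (φ x)).hasDerivAt.comp_hasFDerivAt x (hφ.differentiable x).hasFDerivAt).fderiv
  simp only [SOSMFG.partialDeriv]
  rw [show (fun x => β (φ x)) = β ∘ φ from rfl, h]
  rfl

/-- Integration by parts on `Ω`: no boundary terms, since the supports are compact in `Ω`. -/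
lemma integral_mul_partialDeriv (hφ : IsTest Ω φ) (hψ : IsTest Ω ψ) (i : Fin d) :
    ∫ x in Ω, φ x * partialDeriv i ψ x = - ∫ x in Ω, partialDeriv i φ x * ψ x := by
  have int {f g : Space d → ℝ} (hf : IsTest Ω f) (hg : IsTest Ω g) :
      Integrable (fun x => f x * g x) :=
    (hf.1.continuous.mul hg.1.continuous).integrable_of_hasCompactSupport hf.2.1.mul_right
  have supp {f g : Space d → ℝ} (hg : IsTest Ω g) :
      Function.support (fun x => f x * g x) ⊆ Ω := fun x hx =>
    hg.2.2 (subset_tsupport g (Function.mem_support.2 (right_ne_zero_of_mul hx)))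
  rw [setIntegral_eq_integral_of_forall_compl_eq_zero
      (fun x hx => by_contra fun h => hx (supp (f := φ) (hψ.partialDeriv i) h)),
    setIntegral_eq_integral_of_forall_compl_eq_zero
      (fun x hx => by_contra fun h => hx (supp (f := SOSMFG.partialDeriv i φ) hψ h))]
  exact integral_mul_fderiv_eq_neg_fderiv_mul_of_integrable (int (hφ.partialDeriv i) hψ)
    (int hφ (hψ.partialDeriv i)) (int hφ hψ) (fun x _ => hφ.differentiable x)
    (fun x _ => hψ.differentiable x)

end TestFunctions

section WeakGradient

variable {d : ℕ} {Ω : Set (Space d)}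

lemma inner_eq_integral (u v : L2 Ω) : inner ℝ u v = ∫ x in Ω, u x * v x := by
  rw [L2.inner_def]
  simp [mul_comm]

lemma inner_toLp_right (u : L2 Ω) {φ : Space d → ℝ}
    (hφ : MemLp φ 2 ((volume : Measure (Space d)).restrict Ω)) :
    inner ℝ u (hφ.toLp φ) = ∫ x in Ω, u x * φ x := by
  rw [inner_eq_integral]
  refine integral_congr_ae ?_
  filter_upwards [hφ.coeFn_toLp] with x hx
  rw [hx]

lemma hasWeakGrad_iff {v : L2 Ω} {G : Fin d → L2 Ω} :
    HasWeakGrad v G ↔ ∀ (i : Fin d) (φ : Space d → ℝ) (hφ : IsTest Ω φ),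
      inner ℝ v ((hφ.partialDeriv i).memLp.toLp _) = - inner ℝ (G i) (hφ.memLp.toLp _) := by
  simp only [HasWeakGrad, inner_toLp_right]

/-- An element of `L²(Ω)` orthogonal to all test functions vanishes. -/
lemma eq_zero_of_inner_test (hΩ : IsOpen Ω) {w : L2 Ω}
    (h : ∀ φ : Space d → ℝ, IsTest Ω φ → ∫ x in Ω, w x * φ x = 0) : w = 0 := by
  have hloc : LocallyIntegrableOn (w : Space d → ℝ) Ω volume := by
    rw [locallyIntegrableOn_iff hΩ.isLocallyClosed]
    intro k hk hkc
    have : IsFiniteMeasure (((volume : Measure (Space d)).restrict Ω).restrict k) :=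
      ⟨by simpa using (Measure.restrict_apply_le Ω k).trans_lt hkc.measure_lt_top⟩
    have h1 : IntegrableOn (w : Space d → ℝ) k ((volume : Measure (Space d)).restrict Ω) :=
      ((Lp.memLp w).restrict k).integrable (by norm_num)
    rw [IntegrableOn, Measure.restrict_restrict_of_subset hk] at h1
    exact h1
  have h0 := hΩ.ae_eq_zero_of_integral_contDiff_smul_eq_zero hloc (fun g h1 h2 h3 => by
    rw [← h g ⟨h1, h2, h3⟩, setIntegral_eq_integral_of_forall_compl_eq_zero]
    · simp [mul_comm]
    · intro x hx
      rw [image_eq_zero_of_notMem_tsupport (fun h => hx (h3 h)), mul_zero])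
  rw [Lp.eq_zero_iff_ae_eq_zero]
  exact (ae_restrict_iff' hΩ.measurableSet).2 h0

lemma HasWeakGrad.unique (hΩ : IsOpen Ω) {v : L2 Ω} {G K : Fin d → L2 Ω}
    (hG : HasWeakGrad v G) (hK : HasWeakGrad v K) : G = K := by
  ext1 i
  rw [← sub_eq_zero]
  refine eq_zero_of_inner_test hΩ fun φ hφ => ?_
  rw [← inner_toLp_right _ hφ.memLp, inner_sub_left]
  linarith [hasWeakGrad_iff.1 hG i φ hφ, hasWeakGrad_iff.1 hK i φ hφ]

end WeakGradient

/-! ### The Sobolev space as a closed subspace of pairs (function, gradient) -/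

section SobolevGraph

variable {d : ℕ}

/-- The pairs `(φ, ∇φ)`, where `φ` is a test function on `Ω`. -/
def testGraph (Ω : Set (Space d)) : Submodule ℝ (L2 Ω × (Fin d → L2 Ω)) where
  carrier := {p | ∃ φ : Space d → ℝ, IsTest Ω φ ∧ p.1 =ᵐ[volume.restrict Ω] φ ∧
    ∀ i, p.2 i =ᵐ[volume.restrict Ω] partialDeriv i φ}
  add_mem' := by
    rintro p q ⟨φ, hφ, hp, hp'⟩ ⟨ψ, hψ, hq, hq'⟩
    refine ⟨_, hφ.add hψ, ?_, fun i => ?_⟩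
    · filter_upwards [hp, hq, Lp.coeFn_add p.1 q.1] with x h1 h2 h3
      rw [Prod.fst_add, h3, Pi.add_apply, h1, h2]
    · filter_upwards [hp' i, hq' i, Lp.coeFn_add (p.2 i) (q.2 i)] with x h1 h2 h3
      rw [Prod.snd_add, Pi.add_apply, h3, Pi.add_apply, h1, h2, partialDeriv_add hφ hψ]
  zero_mem' := by
    refine ⟨_, isTest_zero, ?_, fun i => ?_⟩
    · exact Lp.coeFn_zero _ _ _
    · filter_upwards [Lp.coeFn_zero ℝ 2 ((volume : Measure (Space d)).restrict Ω)] with x h1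
      simpa [partialDeriv] using h1
  smul_mem' := by
    rintro c p ⟨φ, hφ, hp, hp'⟩
    refine ⟨_, hφ.const_mul c, ?_, fun i => ?_⟩
    · filter_upwards [hp, Lp.coeFn_smul c p.1] with x h1 h2
      simp [h2, h1]
    · filter_upwards [hp' i, Lp.coeFn_smul c (p.2 i)] with x h1 h2
      simp [h2, h1, partialDeriv_const_mul hφ]

/-- The space `H¹₀(Ω)`, each of its elements `v` being encoded as the pair `(v, ∇v)`: the closure
in `L²(Ω) × L²(Ω)^d` of the pairs `(φ, ∇φ)` with `φ` a test function. -/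
def sobolevGraph (Ω : Set (Space d)) : Submodule ℝ (L2 Ω × (Fin d → L2 Ω)) :=
  (testGraph Ω).topologicalClosure

variable {Ω : Set (Space d)}

lemma isClosed_sobolevGraph : IsClosed (sobolevGraph Ω : Set (L2 Ω × (Fin d → L2 Ω))) :=
  (testGraph Ω).isClosed_topologicalClosure

/-- To check a closed condition on `H¹₀(Ω)` it suffices to check it on test functions. -/
lemma sobolevGraph_induction {P : L2 Ω × (Fin d → L2 Ω) → Prop} (hP : IsClosed {p | P p})
    (h : ∀ p ∈ testGraph Ω, P p) {p : L2 Ω × (Fin d → L2 Ω)} (hp : p ∈ sobolevGraph Ω) : P p :=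
  closure_minimal (t := {p | P p}) (fun p hp => h p hp) hP hp

/-- Green's formula against elements of `H¹₀(Ω)`. -/
lemma HasWeakGrad.inner_gradient {v : L2 Ω} {G : Fin d → L2 Ω} (hG : HasWeakGrad v G)
    {p : L2 Ω × (Fin d → L2 Ω)} (hp : p ∈ sobolevGraph Ω) (i : Fin d) :
    inner ℝ v (p.2 i) = - inner ℝ (G i) p.1 := by
  refine sobolevGraph_induction (P := fun p => inner ℝ v (p.2 i) = - inner ℝ (G i) p.1)
    (isClosed_eq (by fun_prop) (by fun_prop)) ?_ hp
  rintro q ⟨φ, hφ, h1, h2⟩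
  rw [inner_eq_integral, inner_eq_integral,
    integral_congr_ae (g := fun x => v x * partialDeriv i φ x), hG i φ hφ,
    integral_congr_ae (g := fun x => G i x * q.1 x)]
  · filter_upwards [h1] with x hx
    rw [hx]
  · filter_upwards [h2 i] with x hx
    rw [hx]

lemma hasWeakGrad_of_mem {p : L2 Ω × (Fin d → L2 Ω)} (hp : p ∈ sobolevGraph Ω) :
    HasWeakGrad p.1 p.2 := by
  rw [hasWeakGrad_iff]
  intro i ψ hψ
  refine sobolevGraph_induction
    (P := fun p => inner ℝ p.1 ((hψ.partialDeriv i).memLp.toLp _) =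
      - inner ℝ (p.2 i) (hψ.memLp.toLp _))
    (isClosed_eq (by fun_prop) (by fun_prop)) ?_ hp
  rintro q ⟨φ, hφ, h1, h2⟩
  rw [inner_toLp_right, inner_toLp_right,
    integral_congr_ae (g := fun x => φ x * partialDeriv i ψ x),
    integral_mul_partialDeriv hφ hψ, integral_congr_ae (g := fun x => q.2 i x * ψ x)]
  · filter_upwards [h2 i] with x hx
    rw [hx]
  · filter_upwards [h1] with x hx
    rw [hx]

lemma memH10_of_mem {p : L2 Ω × (Fin d → L2 Ω)} (hp : p ∈ sobolevGraph Ω) : MemH10 p.1 := by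
  obtain ⟨q, hq, hlim⟩ := mem_closure_iff_seq_limit.1
    (show p ∈ closure (testGraph Ω : Set (L2 Ω × (Fin d → L2 Ω))) from hp)
  choose φ hφ h1 h2 using hq
  rw [Prod.tendsto_iff, tendsto_pi_nhds] at hlim
  refine ⟨p.2, hasWeakGrad_of_mem hp, φ, hφ, ?_, fun i => ?_⟩
  · refine ((Lp.tendsto_Lp_iff_tendsto_eLpNorm' _ _).1 hlim.1).congr fun n => ?_
    refine eLpNorm_congr_ae ?_
    filter_upwards [h1 n] with x hx
    simp [hx]
  · refine ((Lp.tendsto_Lp_iff_tendsto_eLpNorm' _ _).1 (hlim.2 i)).congr fun n => ?_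
    refine eLpNorm_congr_ae ?_
    filter_upwards [h2 n i] with x hx
    simp [hx]

lemma MemH10.exists_mem {v : L2 Ω} (hv : MemH10 v) : ∃ G, (v, G) ∈ sobolevGraph Ω := by
  obtain ⟨G, -, φ, hφ, h1, h2⟩ := hv
  refine ⟨G, mem_closure_iff_seq_limit.2 ⟨fun n => ((hφ n).memLp.toLp (φ n),
    fun i => ((hφ n).partialDeriv i).memLp.toLp (partialDeriv i (φ n))),
    fun n => ⟨φ n, hφ n, ?_, fun i => ?_⟩, ?_⟩⟩
  · exact MemLp.coeFn_toLp (hφ n).memLp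
  · exact MemLp.coeFn_toLp ((hφ n).partialDeriv i).memLp
  · rw [Prod.tendsto_iff, tendsto_pi_nhds]
    refine ⟨?_, fun i => ?_⟩
    · refine (Lp.tendsto_Lp_iff_tendsto_eLpNorm' _ _).2 (h1.congr fun n => ?_)
      refine eLpNorm_congr_ae ?_
      filter_upwards [(hφ n).memLp.coeFn_toLp] with x hx
      simp [hx]
    · refine (Lp.tendsto_Lp_iff_tendsto_eLpNorm' _ _).2 ((h2 i).congr fun n => ?_)
      refine eLpNorm_congr_ae ?_
      filter_upwards [((hφ n).partialDeriv i).memLp.coeFn_toLp] with x hx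
      simp [hx]

lemma MemH10.mem (hΩ : IsOpen Ω) {v : L2 Ω} (hv : MemH10 v) {G : Fin d → L2 Ω}
    (hG : HasWeakGrad v G) : (v, G) ∈ sobolevGraph Ω := by
  obtain ⟨K, hK⟩ := hv.exists_mem
  rwa [hG.unique hΩ (hasWeakGrad_of_mem hK)]

end SobolevGraph

/-! ### Positive parts in the Sobolev space -/

section Truncation

/-- Dominated convergence for products in `L²`: a bounded sequence of multipliers converging almost
everywhere, times a sequence converging in `L²`. -/
lemma tendsto_L2_mul {α : Type*} [MeasurableSpace α] {μ : Measure α} {C : ℝ}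
    {b : ℕ → α → ℝ} {b' : α → ℝ} {g K : ℕ → Lp ℝ 2 μ} {g' K' : Lp ℝ 2 μ}
    (hbm : ∀ n, AEStronglyMeasurable (b n) μ) (hbC : ∀ n x, |b n x| ≤ C)
    (hb : ∀ᵐ x ∂μ, Tendsto (fun n => b n x) atTop (𝓝 (b' x)))
    (hg : Tendsto g atTop (𝓝 g'))
    (hK : ∀ n, K n =ᵐ[μ] fun x => b n x * g n x) (hK' : K' =ᵐ[μ] fun x => b' x * g' x) :
    Tendsto K atTop (𝓝 K') := by
  have hmem : ∀ n, MemLp (fun x => b n x * g' x) 2 μ := fun n =>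
    (Lp.memLp g').of_le_mul (c := C) ((hbm n).mul (Lp.aestronglyMeasurable g'))
      (Eventually.of_forall fun x => by
        rw [norm_mul]
        exact mul_le_mul_of_nonneg_right (hbC n x) (norm_nonneg _))
  set D : ℕ → Lp ℝ 2 μ := fun n => (hmem n).toLp _
  have hD : ∀ n, D n =ᵐ[μ] fun x => b n x * g' x := fun n => (hmem n).coeFn_toLp
  have h1 : Tendsto (fun n => K n - D n) atTop (𝓝 0) := by
    have h0 : Tendsto (fun n => C * ‖g n - g'‖) atTop (𝓝 0) := by
      simpa using ((tendsto_iff_norm_sub_tendsto_zero.1 hg).const_mul C)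
    refine squeeze_zero_norm (fun n => ?_) h0
    refine Lp.norm_le_mul_norm_of_ae_le_mul ?_
    filter_upwards [hK n, hD n, Lp.coeFn_sub (K n) (D n), Lp.coeFn_sub (g n) g'] with x e1 e2 e3 e4
    rw [e3, e4, Pi.sub_apply, Pi.sub_apply, e1, e2, ← mul_sub, norm_mul]
    exact mul_le_mul_of_nonneg_right (hbC n x) (norm_nonneg _)
  have h2 : Tendsto (fun n => D n - K') atTop (𝓝 0) := by
    have hsq : ∀ n, ‖D n - K'‖ ^ 2 = ∫ x, ((b n x - b' x) * g' x) ^ 2 ∂μ := fun n => by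
      rw [← real_inner_self_eq_norm_sq, L2.inner_def]
      refine integral_congr_ae ?_
      filter_upwards [hD n, hK', Lp.coeFn_sub (D n) K'] with x e1 e2 e3
      rw [e3, Pi.sub_apply, e1, e2]
      simp only [RCLike.inner_apply, conj_trivial]
      ring
    have hlim : Tendsto (fun n => ‖D n - K'‖ ^ 2) atTop (𝓝 0) := by
      simp only [hsq]
      have hint : Integrable (fun x => (2 * C) ^ 2 * (g' x) ^ 2) μ :=
        (Lp.memLp g').integrable_sq.const_mul _
      have := tendsto_integral_of_dominated_convergence (μ := μ)
        (F := fun n x => ((b n x - b' x) * g' x) ^ 2) (f := fun _ => (0 : ℝ)) _ (fun n => ?_)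
        hint (fun n => ?_) ?_
      · simpa using this
      · have : AEStronglyMeasurable (fun x => (D n - K') x ^ 2) μ :=
          (Lp.aestronglyMeasurable _).pow 2
        refine this.congr ?_
        filter_upwards [hD n, hK', Lp.coeFn_sub (D n) K'] with x e1 e2 e3
        rw [e3, Pi.sub_apply, e1, e2]
        ring
      · filter_upwards [hb] with x hx
        have hC' : |b' x| ≤ C := le_of_tendsto hx.abs (Eventually.of_forall fun n => hbC n x)
        have hle : |b n x - b' x| ≤ 2 * C := (abs_sub _ _).trans (by linarith [hbC n x])
        rw [Real.norm_of_nonneg (sq_nonneg _), mul_pow]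
        refine mul_le_mul_of_nonneg_right ?_ (sq_nonneg _)
        exact sq_le_sq' (by linarith [(abs_le.1 hle).1]) (abs_le.1 hle).2
      · filter_upwards [hb] with x hx
        have := (((hx.sub_const (b' x)).mul_const (g' x)).pow 2)
        simpa using this
    rw [tendsto_zero_iff_norm_tendsto_zero]
    have := hlim.sqrt
    simpa using this
  have := (h1.add h2).add_const K'
  simpa using this

variable {d : ℕ} {Ω : Set (Space d)}

/-- The chain rule in `H¹₀(Ω)`, for a smooth function with bounded derivative. -/
lemma sobolevGraph_comp {β : ℝ → ℝ} (hβ : ContDiff ℝ ∞ β) (h0 : β 0 = 0) {C : ℝ}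
    (hC : ∀ s, |deriv β s| ≤ C) {p q : L2 Ω × (Fin d → L2 Ω)} (hp : p ∈ sobolevGraph Ω)
    (hq1 : q.1 =ᵐ[volume.restrict Ω] fun x => β (p.1 x))
    (hq2 : ∀ i, q.2 i =ᵐ[volume.restrict Ω] fun x => deriv β (p.1 x) * p.2 i x) :
    q ∈ sobolevGraph Ω := by
  have hβd : Differentiable ℝ β := hβ.differentiable (by simp)
  have hβ' : Continuous (deriv β) := hβ.continuous_deriv (by simp)
  have hlip : ∀ s t, |β s - β t| ≤ C * |s - t| := fun s t =>
    Convex.norm_image_sub_le_of_norm_deriv_le (s := Set.univ) (fun x _ => hβd x)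
      (fun x _ => hC x) convex_univ (Set.mem_univ t) (Set.mem_univ s)
  obtain ⟨r, hr, hlim⟩ := mem_closure_iff_seq_limit.1
    (show p ∈ closure (testGraph Ω : Set (L2 Ω × (Fin d → L2 Ω))) from hp)
  rw [Prod.tendsto_iff, tendsto_pi_nhds] at hlim
  obtain ⟨ns, hns, hae⟩ := (tendstoInMeasure_of_tendsto_Lp hlim.1).exists_seq_tendsto_ae
  choose φ hφ h1 h2 using fun n => hr (ns n)
  have hψ : ∀ n, IsTest Ω (fun x => β (φ n x)) := fun n => (hφ n).comp_left hβ h0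
  refine mem_closure_iff_seq_limit.2 ⟨fun n => ((hψ n).memLp.toLp _,
    fun i => ((hψ n).partialDeriv i).memLp.toLp _), fun n => ⟨_, hψ n, ?_, fun i => ?_⟩, ?_⟩
  · exact (hψ n).memLp.coeFn_toLp
  · exact ((hψ n).partialDeriv i).memLp.coeFn_toLp
  rw [Prod.tendsto_iff, tendsto_pi_nhds]
  refine ⟨?_, fun i => ?_⟩
  · rw [tendsto_iff_norm_sub_tendsto_zero]
    have hz : Tendsto (fun n => C * ‖(r (ns n)).1 - p.1‖) atTop (𝓝 0) := by
      simpa using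
        ((tendsto_iff_norm_sub_tendsto_zero.1 (hlim.1.comp hns.tendsto_atTop)).const_mul C)
    refine squeeze_zero (fun n => norm_nonneg _) (fun n => ?_) hz
    refine Lp.norm_le_mul_norm_of_ae_le_mul ?_
    filter_upwards [(hψ n).memLp.coeFn_toLp, h1 n, hq1, Lp.coeFn_sub (r (ns n)).1 p.1,
      Lp.coeFn_sub ((hψ n).memLp.toLp _) q.1] with x e1 e2 e3 e4 e5
    rw [e5, e4, Pi.sub_apply, Pi.sub_apply, e1, e2, e3]
    exact hlip _ _
  · refine tendsto_L2_mul (C := C) (b := fun n x => deriv β (φ n x))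
      (b' := fun x => deriv β (p.1 x)) (g := fun n => (r (ns n)).2 i) (g' := p.2 i)
      (fun n => (hβ'.comp (hφ n).1.continuous).aestronglyMeasurable) (fun n x => hC _) ?_
      ((hlim.2 i).comp hns.tendsto_atTop) (fun n => ?_) (hq2 i)
    · filter_upwards [hae, ae_all_iff.2 h1] with x hx hx1
      simp only [hx1] at hx
      exact (hβ'.tendsto _).comp hx
    · filter_upwards [((hψ n).partialDeriv i).memLp.coeFn_toLp, h2 n i] with x e1 e2
      rw [e1, e2, partialDeriv_comp_left (hφ n) hβd]

/-- A smooth approximation of the positive part: it is `0` on `(-∞, 0]` and `s` on `[1, ∞)`. -/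
def smoothPos (s : ℝ) : ℝ := s * Real.smoothTransition s

lemma contDiff_smoothPos : ContDiff ℝ ∞ smoothPos :=
  contDiff_id.mul Real.smoothTransition.contDiff

lemma hasDerivAt_smoothPos (s : ℝ) : HasDerivAt smoothPos
    (Real.smoothTransition s + s * deriv Real.smoothTransition s) s := by
  have h := (hasDerivAt_id s).mul
    ((Real.smoothTransition.contDiff (n := 1)).differentiable (by simp) s).hasDerivAt
  rw [one_mul] at h
  exact h

lemma deriv_smoothPos_of_nonpos {s : ℝ} (hs : s ≤ 0) : deriv smoothPos s = 0 := by
  rw [(hasDerivAt_smoothPos s).deriv, Real.smoothTransition.zero_of_nonpos hs, zero_add]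
  rcases hs.lt_or_eq with h | rfl
  · have : Real.smoothTransition =ᶠ[𝓝 s] fun _ => 0 := by
      filter_upwards [Iio_mem_nhds h] with t ht
      exact Real.smoothTransition.zero_of_nonpos (le_of_lt ht)
    rw [this.deriv_eq, deriv_const, mul_zero]
  · rw [zero_mul]

lemma deriv_smoothPos_of_one_lt {s : ℝ} (hs : 1 < s) : deriv smoothPos s = 1 := by
  have : Real.smoothTransition =ᶠ[𝓝 s] fun _ => 1 := by
    filter_upwards [Ioi_mem_nhds hs] with t ht
    exact Real.smoothTransition.one_of_one_le (le_of_lt ht)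
  rw [(hasDerivAt_smoothPos s).deriv, this.deriv_eq, deriv_const,
    Real.smoothTransition.one_of_one_le hs.le]
  ring

lemma exists_abs_deriv_smoothPos_le : ∃ C, ∀ s, |deriv smoothPos s| ≤ C := by
  obtain ⟨C, hC⟩ := (isCompact_Icc (a := (0 : ℝ)) (b := 1)).exists_bound_of_continuousOn
    (contDiff_smoothPos.continuous_deriv (by simp)).continuousOn
  refine ⟨max C 1, fun s => ?_⟩
  rcases le_or_gt s 0 with h | h
  · simp [deriv_smoothPos_of_nonpos h]
  rcases le_or_gt s 1 with h1 | h1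
  · exact (hC s ⟨h.le, h1⟩).trans (le_max_left _ _)
  · simp [deriv_smoothPos_of_one_lt h1]

/-- `H¹₀(Ω)` is stable under positive parts, with `∇v⁺ = 1_{v > 0} ∇v`. -/
lemma sobolevGraph_posPart {p : L2 Ω × (Fin d → L2 Ω)} (hp : p ∈ sobolevGraph Ω) :
    ∃ q ∈ sobolevGraph Ω, (q.1 =ᵐ[volume.restrict Ω] fun x => max (p.1 x) 0) ∧
      ∀ i, q.2 i =ᵐ[volume.restrict Ω] fun x => if 0 < p.1 x then p.2 i x else 0 := by
  obtain ⟨C, hC⟩ := exists_abs_deriv_smoothPos_le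
  set b' : Space d → ℝ := fun x => if 0 < p.1 x then 1 else 0 with hb'
  have hk : ∀ n : ℕ, (0 : ℝ) < n + 1 := fun n => by positivity
  have hpm : Measurable p.1 := (Lp.stronglyMeasurable p.1).measurable
  have hb'm : Measurable b' :=
    Measurable.ite (measurableSet_lt measurable_const hpm) measurable_const measurable_const
  have hderc : Continuous (deriv smoothPos) := contDiff_smoothPos.continuous_deriv (by simp)
  have tend_lin : ∀ s : ℝ, 0 < s → ∀ᶠ n : ℕ in atTop, 1 < ((n : ℝ) + 1) * s := fun s hs => by
    have : Tendsto (fun n : ℕ => ((n : ℝ) + 1) * s) atTop atTop :=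
      (tendsto_atTop_add_const_right _ _ tendsto_natCast_atTop_atTop).atTop_mul_const hs
    exact this.eventually_gt_atTop 1
  -- both multipliers used below converge to the indicator of `{v > 0}`
  have lim : ∀ (T : ℝ → ℝ), (∀ s ≤ 0, T s = 0) → (∀ s, 1 < s → T s = 1) → ∀ x,
      Tendsto (fun n : ℕ => T (((n : ℝ) + 1) * p.1 x)) atTop (𝓝 (b' x)) := by
    intro T hT0 hT1 x
    by_cases h : 0 < p.1 x
    · simp only [hb', h, if_true]
      exact tendsto_const_nhds.congr' ((tend_lin _ h).mono fun n hn => (hT1 _ hn).symm)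
    · simp only [hb', h, if_false]
      exact tendsto_const_nhds.congr fun n =>
        (hT0 _ (mul_nonpos_of_nonneg_of_nonpos (hk n).le (not_lt.1 h))).symm
  have memmul : ∀ (b : Space d → ℝ) (B : ℝ), Measurable b → (∀ x, |b x| ≤ B) → ∀ g : L2 Ω,
      MemLp (fun x => b x * g x) 2 (volume.restrict Ω) := fun b B hbm hbB g =>
    (Lp.memLp g).of_le_mul (c := B)
      (hbm.aestronglyMeasurable.mul (Lp.aestronglyMeasurable g))
      (Eventually.of_forall fun x => by
        rw [norm_mul]
        exact mul_le_mul_of_nonneg_right (hbB x) (norm_nonneg _))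
  have hb'1 : ∀ x, |b' x| ≤ 1 := fun x => by
    simp only [hb']
    split_ifs <;> simp
  have hT1 : ∀ s, |Real.smoothTransition s| ≤ 1 := fun s => by
    rw [abs_of_nonneg (Real.smoothTransition.nonneg s)]
    exact Real.smoothTransition.le_one s
  have hm1 : ∀ n : ℕ, Measurable fun x => Real.smoothTransition (((n : ℝ) + 1) * p.1 x) :=
    fun n => Real.smoothTransition.continuous.measurable.comp (hpm.const_mul _)
  have hm2 : ∀ n : ℕ, Measurable fun x => deriv smoothPos (((n : ℝ) + 1) * p.1 x) :=
    fun n => hderc.measurable.comp (hpm.const_mul _)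
  have M1 := fun n : ℕ => memmul _ _ (hm1 n) (fun x => hT1 _) p.1
  have M2 := fun (n : ℕ) i => memmul _ _ (hm2 n) (fun x => hC _) (p.2 i)
  have M1' := memmul _ _ hb'm hb'1 p.1
  have M2' := fun i => memmul _ _ hb'm hb'1 (p.2 i)
  refine ⟨(M1'.toLp _, fun i => (M2' i).toLp _), ?_, ?_, fun i => ?_⟩
  · refine isClosed_sobolevGraph.mem_of_tendsto
      (f := fun n : ℕ => ((M1 n).toLp _, fun i => (M2 n i).toLp _)) (b := atTop) ?_
      (Eventually.of_forall fun n => ?_)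
    · rw [Prod.tendsto_iff, tendsto_pi_nhds]
      refine ⟨?_, fun i => ?_⟩
      · exact tendsto_L2_mul (fun n => (hm1 n).aestronglyMeasurable) (fun n x => hT1 _)
          (Eventually.of_forall (lim _ (fun s hs => Real.smoothTransition.zero_of_nonpos hs)
            (fun s hs => Real.smoothTransition.one_of_one_le hs.le)))
          tendsto_const_nhds (fun n => (M1 n).coeFn_toLp) M1'.coeFn_toLp
      · exact tendsto_L2_mul (fun n => (hm2 n).aestronglyMeasurable) (fun n x => hC _)
          (Eventually.of_forall (lim _ (fun s hs => deriv_smoothPos_of_nonpos hs)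
            (fun s hs => deriv_smoothPos_of_one_lt hs)))
          tendsto_const_nhds (fun n => (M2 n i).coeFn_toLp) (M2' i).coeFn_toLp
    · -- the approximation `s ↦ smoothPos ((n + 1) s) / (n + 1)` has the multipliers in question
      have hder : ∀ s, deriv (fun s => smoothPos (((n : ℝ) + 1) * s) / ((n : ℝ) + 1)) s =
          deriv smoothPos (((n : ℝ) + 1) * s) := fun s => by
        have h := (((hasDerivAt_smoothPos (((n : ℝ) + 1) * s)).differentiableAt.hasDerivAt.comp s
          ((hasDerivAt_id s).const_mul ((n : ℝ) + 1))).div_const ((n : ℝ) + 1)).deriv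
        refine h.trans ?_
        have := (hk n).ne'
        field_simp
      refine sobolevGraph_comp (β := fun s => smoothPos (((n : ℝ) + 1) * s) / ((n : ℝ) + 1))
        ((contDiff_smoothPos.comp (contDiff_const.mul contDiff_id)).div_const _)
        (by simp [smoothPos]) (C := C) (fun s => by rw [hder]; exact hC _) hp ?_ fun i => ?_
      · filter_upwards [(M1 n).coeFn_toLp] with x hx
        rw [hx, smoothPos]
        have := (hk n).ne'
        field_simp
      · filter_upwards [(M2 n i).coeFn_toLp] with x hx
        rw [hx, hder]
  · filter_upwards [M1'.coeFn_toLp] with x hx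
    rw [hx]
    simp only [hb']
    split_ifs with h
    · rw [one_mul, max_eq_left h.le]
    · rw [zero_mul, max_eq_right (not_lt.1 h)]
  · filter_upwards [(M2' i).coeFn_toLp] with x hx
    rw [hx]
    simp only [hb']
    split_ifs with h
    · rw [one_mul]
    · rw [zero_mul]

end Truncation

/-! ### Capacity and quasi-continuity -/

section Capacity

variable {d : ℕ} {Ω : Set (Space d)}

lemma capacity_mono {A B : Set (Space d)} (h : A ⊆ B) : capacity Ω A ≤ capacity Ω B := by
  refine sInf_le_sInf ?_
  rintro c ⟨U, v, G, hU, hB, hrest⟩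
  exact ⟨U, v, G, hU, h.trans hB, hrest⟩

lemma enorm_add_sq_le {E : Type*} [NormedAddCommGroup E] (x y : E) :
    ‖x + y‖ₑ ^ 2 ≤ 2 * (‖x‖ₑ ^ 2 + ‖y‖ₑ ^ 2) := by
  refine (pow_le_pow_left' (enorm_add_le x y) 2).trans ?_
  have h := add_pow_le (zero_le : 0 ≤ ‖x‖₊) (zero_le : 0 ≤ ‖y‖₊) 2
  rw [Nat.add_one_sub_one, pow_one] at h
  rw [enorm_eq_nnnorm, enorm_eq_nnnorm]
  exact_mod_cast h

/-- A weak form of the subadditivity of capacity. The competitor for `A ∪ B` is the sum of the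
positive parts of competitors for `A` and `B`. -/
lemma capacity_union_lt (hΩ : IsOpen Ω) {A B : Set (Space d)} {a b : ℝ≥0∞}
    (hA : capacity Ω A < a) (hB : capacity Ω B < b) : capacity Ω (A ∪ B) < 2 * (a + b) := by
  have hnorm : ∀ {u w : L2 Ω}, (∀ᵐ x ∂(volume.restrict Ω), ‖u x‖ ≤ ‖w x‖) → ‖u‖ₑ ≤ ‖w‖ₑ :=
    fun h => by
      rw [Lp.enorm_def, Lp.enorm_def]
      exact eLpNorm_mono_ae h
  obtain ⟨_, ⟨U, v, G, hU, hAU, hUΩ, hv, hG, hv1, rfl⟩, hc₁⟩ := sInf_lt_iff.1 hA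
  obtain ⟨_, ⟨V, w, K, hV, hBV, hVΩ, hw, hK, hw1, rfl⟩, hc₂⟩ := sInf_lt_iff.1 hB
  obtain ⟨p, hp, hp1, hp2⟩ := sobolevGraph_posPart (hv.mem hΩ hG)
  obtain ⟨q, hq, hq1, hq2⟩ := sobolevGraph_posPart (hw.mem hΩ hK)
  have hpq := (sobolevGraph Ω).add_mem hp hq
  have hsum : (p + q).1 =ᵐ[volume.restrict Ω] fun x => max (v x) 0 + max (w x) 0 := by
    filter_upwards [hp1, hq1, Lp.coeFn_add p.1 q.1] with x e1 e2 e3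
    rw [Prod.fst_add, e3, Pi.add_apply, e1, e2]
  have hcap : capacity Ω (A ∪ B) ≤ ‖(p + q).1‖ₑ ^ 2 + ∑ i, ‖(p + q).2 i‖ₑ ^ 2 := by
    refine sInf_le ⟨U ∪ V, (p + q).1, (p + q).2, hU.union hV, Set.union_subset_union hAU hBV,
      Set.union_subset hUΩ hVΩ, memH10_of_mem hpq, hasWeakGrad_of_mem hpq, ?_, rfl⟩
    rw [ae_restrict_union_iff]
    constructor
    · filter_upwards [hv1, ae_restrict_of_ae_restrict_of_subset hUΩ hsum] with x e1 e2
      rw [e2]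
      linarith [le_max_left (v x) 0, le_max_right (w x) 0]
    · filter_upwards [hw1, ae_restrict_of_ae_restrict_of_subset hVΩ hsum] with x e1 e2
      rw [e2]
      linarith [le_max_left (w x) 0, le_max_right (v x) 0]
  have n1 : ‖p.1‖ₑ ≤ ‖v‖ₑ := hnorm (by
    filter_upwards [hp1] with x e1
    rw [e1, Real.norm_of_nonneg (le_max_right _ _)]
    exact max_le (le_abs_self _) (abs_nonneg _))
  have n2 : ‖q.1‖ₑ ≤ ‖w‖ₑ := hnorm (by
    filter_upwards [hq1] with x e1
    rw [e1, Real.norm_of_nonneg (le_max_right _ _)]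
    exact max_le (le_abs_self _) (abs_nonneg _))
  have n3 : ∀ i, ‖p.2 i‖ₑ ≤ ‖G i‖ₑ := fun i => hnorm (by
    filter_upwards [hp2 i] with x e1
    rw [e1]
    split_ifs <;> simp)
  have n4 : ∀ i, ‖q.2 i‖ₑ ≤ ‖K i‖ₑ := fun i => hnorm (by
    filter_upwards [hq2 i] with x e1
    rw [e1]
    split_ifs <;> simp)
  refine lt_of_le_of_lt ?_ ((ENNReal.mul_lt_mul_iff_right (by simp) (by simp)).2
    (ENNReal.add_lt_add hc₁ hc₂))
  calc capacity Ω (A ∪ B) ≤ ‖(p + q).1‖ₑ ^ 2 + ∑ i, ‖(p + q).2 i‖ₑ ^ 2 := hcap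
    _ ≤ 2 * (‖v‖ₑ ^ 2 + ‖w‖ₑ ^ 2) + ∑ i, 2 * (‖G i‖ₑ ^ 2 + ‖K i‖ₑ ^ 2) := by
      refine add_le_add ((enorm_add_sq_le _ _).trans ?_)
        (Finset.sum_le_sum fun i _ => (enorm_add_sq_le _ _).trans ?_)
      · gcongr
      · gcongr
        · exact n3 i
        · exact n4 i
    _ = _ := by
      rw [← Finset.mul_sum, Finset.sum_add_distrib]
      ring

lemma capacity_empty : capacity Ω ∅ = 0 := by
  refine le_antisymm (sInf_le ⟨∅, 0, 0, isOpen_empty, subset_rfl, Set.empty_subset _,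
    memH10_of_mem (sobolevGraph Ω).zero_mem, hasWeakGrad_of_mem (sobolevGraph Ω).zero_mem,
    by simp, by simp⟩) zero_le

/-- By Chebyshev's inequality, the capacity dominates Lebesgue measure. -/
lemma volume_le_capacity (A : Set (Space d)) : volume A ≤ capacity Ω A := by
  refine le_sInf ?_
  rintro c ⟨U, v, G, hU, hAU, hUΩ, hv, hG, hv1, rfl⟩
  have h1 : volume U ≤ (volume.restrict Ω) {x | (1 : ℝ≥0∞) ≤ ‖v x‖ₑ} := by
    rw [← Measure.restrict_apply_self volume U]
    refine (measure_mono_ae ?_).trans (Measure.restrict_mono hUΩ le_rfl _)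
    filter_upwards [hv1] with x hx _
    show (1 : ℝ≥0∞) ≤ ‖v x‖ₑ
    rw [Real.enorm_eq_ofReal (zero_le_one.trans hx)]
    exact ENNReal.one_le_ofReal.2 hx
  have h2 := meas_ge_le_mul_pow_eLpNorm_enorm ((volume : Measure (Space d)).restrict Ω)
    two_ne_zero ENNReal.ofNat_ne_top (Lp.aestronglyMeasurable v) one_ne_zero (by simp)
  have h3 : volume A ≤ ‖v‖ₑ ^ 2 := by
    refine (measure_mono hAU).trans (h1.trans (h2.trans_eq ?_))
    simp [Lp.enorm_def]
  exact h3.trans le_self_add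

lemma QuasiContinuous.comp {g : Space d → ℝ} (hg : QuasiContinuous Ω g) {F : ℝ → ℝ}
    (hF : Continuous F) : QuasiContinuous Ω (fun x => F (g x)) := fun ε hε => by
  obtain ⟨U, h1, h2, h3, h4⟩ := hg ε hε
  exact ⟨U, h1, h2, h3, hF.comp_continuousOn h4⟩

lemma QuasiContinuous.comp₂ (hΩ : IsOpen Ω) {g h : Space d → ℝ} (hg : QuasiContinuous Ω g)
    (hh : QuasiContinuous Ω h) {F : ℝ × ℝ → ℝ} (hF : Continuous F) :
    QuasiContinuous Ω (fun x => F (g x, h x)) := fun ε hε => by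
  obtain ⟨δ, hδ, hδε⟩ : ∃ δ : ℝ≥0∞, 0 < δ ∧ 2 * (δ + δ) ≤ ε := by
    refine ⟨ε / 4, ENNReal.div_pos hε.ne' (by simp), ?_⟩
    rw [← two_mul, ← mul_assoc, show (2 : ℝ≥0∞) * 2 = 4 by norm_num]
    exact ENNReal.mul_div_le
  obtain ⟨U, h1, h2, h3, h4⟩ := hg δ hδ
  obtain ⟨V, k1, k2, k3, k4⟩ := hh δ hδ
  refine ⟨U ∪ V, h1.union k1, Set.union_subset h2 k2, ?_, hF.comp_continuousOn ?_⟩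
  · exact (capacity_union_lt hΩ h3 k3).trans_le hδε
  · exact (h4.mono (Set.sdiff_subset_sdiff_right Set.subset_union_left)).prodMk
      (k4.mono (Set.sdiff_subset_sdiff_right Set.subset_union_right))

/-- Elements of `H¹₀(W)` vanish almost everywhere outside `W`. -/
lemma MemH10On.ae_eq_zero (hΩ : IsOpen Ω) {W : Set (Space d)} {v : L2 Ω} (hv : MemH10On W v) :
    ∀ᵐ x ∂(volume.restrict Ω), x ∉ W → v x = 0 := by
  obtain ⟨-, g, ⟨-, hg⟩, h0⟩ := hv
  have hn : ∀ᵐ x ∂(volume.restrict Ω), x ∉ {x ∈ Ω \ W | g x ≠ 0} :=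
    ae_restrict_of_ae (measure_eq_zero_iff_ae_notMem.1
      (le_antisymm ((volume_le_capacity _).trans_eq h0) zero_le))
  filter_upwards [hg, hn, ae_restrict_mem hΩ.measurableSet] with x e1 e2 hx hW
  rw [← e1]
  by_contra hne
  exact e2 ⟨⟨hx, hW⟩, hne⟩

/-- `H¹₀(W)` is an order ideal: if `v ∈ H¹₀(W)` and `w ∈ H¹₀(Ω)` is obtained from `v` and a
quasi-continuous function by a continuous operation vanishing where `v` does, then `w ∈ H¹₀(W)`. -/
lemma MemH10On.comp₂ (hΩ : IsOpen Ω) {W : Set (Space d)} {v w u : L2 Ω} (hv : MemH10On W v)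
    {h : Space d → ℝ} (hh : IsQuasiContRep h u) {F : ℝ × ℝ → ℝ} (hF : Continuous F)
    (hF0 : ∀ t, F (0, t) = 0) (hw : MemH10 w)
    (hwF : w =ᵐ[volume.restrict Ω] fun x => F (v x, u x)) : MemH10On W w := by
  obtain ⟨-, g, ⟨hgc, hg⟩, h0⟩ := hv
  refine ⟨hw, fun x => F (g x, h x), ⟨hgc.comp₂ hΩ hh.1 hF, ?_⟩, ?_⟩
  · filter_upwards [hg, hh.2, hwF] with x e1 e2 e3
    rw [e1, e2, e3]
  · refine le_antisymm ((capacity_mono ?_).trans_eq h0) zero_le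
    rintro x ⟨hx, hne⟩
    refine ⟨hx, fun h => hne ?_⟩
    simp only [h, hF0]

end Capacity

/-! ### The energy form -/

section Energy

variable {d : ℕ} {Ω : Set (Space d)}

/-- The bilinear form `∫ v w + ∫ ∇v · ∇w` of the operator `-Δ + 1`, on pairs `(v, ∇v)`. -/
def energy (p q : L2 Ω × (Fin d → L2 Ω)) : ℝ :=
  inner ℝ p.1 q.1 + ∑ i, inner ℝ (p.2 i) (q.2 i)

variable (p q r : L2 Ω × (Fin d → L2 Ω))

lemma energy_comm : energy p q = energy q p := by
  simp only [energy, real_inner_comm]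

lemma energy_sub_left : energy (p - q) r = energy p r - energy q r := by
  simp only [energy, Prod.fst_sub, Prod.snd_sub, Pi.sub_apply, inner_sub_left,
    Finset.sum_sub_distrib]
  ring

lemma energy_sub_right : energy p (q - r) = energy p q - energy p r := by
  rw [energy_comm, energy_sub_left, energy_comm q, energy_comm r]

lemma energy_smul_left (c : ℝ) : energy (c • p) q = c * energy p q := by
  simp only [energy, Prod.smul_fst, Prod.smul_snd, Pi.smul_apply, real_inner_smul_left,
    mul_add, Finset.mul_sum]

lemma energy_smul_right (c : ℝ) : energy p (c • q) = c * energy p q := by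
  rw [energy_comm, energy_smul_left, energy_comm]

lemma energy_neg_left : energy (-p) q = - energy p q := by
  rw [← neg_one_smul ℝ p, energy_smul_left, neg_one_mul]

lemma energy_neg_right : energy p (-q) = - energy p q := by
  rw [energy_comm, energy_neg_left, energy_comm]

lemma norm_sq_le_energy_self : ‖p.1‖ ^ 2 ≤ energy p p := by
  rw [energy, real_inner_self_eq_norm_sq]
  exact le_add_of_nonneg_right (Finset.sum_nonneg fun i _ => real_inner_self_nonneg)

lemma inner_nonneg_of_ae {u v : L2 Ω} (h : ∀ᵐ x ∂(volume.restrict Ω), 0 ≤ u x * v x) :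
    0 ≤ inner ℝ u v := by
  rw [inner_eq_integral]
  exact integral_nonneg_of_ae h

variable {p q}

/-- The energy form is coercive on positive parts: `‖v⁺‖² ≤ ∫ v v⁺ + ∫ ∇v · ∇v⁺`. -/
lemma norm_sq_le_energy_posPart (hq1 : q.1 =ᵐ[volume.restrict Ω] fun x => max (p.1 x) 0)
    (hq2 : ∀ i, q.2 i =ᵐ[volume.restrict Ω] fun x => if 0 < p.1 x then p.2 i x else 0) :
    ‖q.1‖ ^ 2 ≤ energy p q := by
  have h1 : inner ℝ p.1 q.1 = ‖q.1‖ ^ 2 := by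
    rw [← real_inner_self_eq_norm_sq, inner_eq_integral, inner_eq_integral]
    refine integral_congr_ae ?_
    filter_upwards [hq1] with x hx
    rw [hx]
    rcases le_total (p.1 x) 0 with h | h
    · simp [max_eq_right h]
    · simp [max_eq_left h]
  rw [energy, h1]
  refine le_add_of_nonneg_right (Finset.sum_nonneg fun i _ => inner_nonneg_of_ae ?_)
  filter_upwards [hq2 i] with x hx
  rw [hx]
  split_ifs
  · exact mul_self_nonneg _
  · simp

end Energy

/-! ### The Dirichlet problem -/

section Dirichlet

variable {d : ℕ} {Ω : Set (Space d)} {ρ : Space d → ℝ} {W : Set (Space d)} {m : L2 Ω}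

lemma SolvesDirichlet.energy_eq (hρ : IsTest Ω ρ) {p q : L2 Ω × (Fin d → L2 Ω)}
    (hp : p ∈ sobolevGraph Ω) (hm : SolvesDirichlet ρ W p.1) (hq : q ∈ sobolevGraph Ω)
    (hqW : MemH10On W q.1) : energy p q = inner ℝ (hρ.memLp.toLp ρ) q.1 := by
  have h := hm.2 q.1 hqW p.2 q.2 (hasWeakGrad_of_mem hp) (hasWeakGrad_of_mem hq)
  simp only [← inner_eq_integral] at h
  rw [energy, add_comm, h, real_inner_comm, inner_toLp_right]
  simp only [mul_comm]

/-- The weak maximum principle: the negative part is an admissible test function. -/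
lemma SolvesDirichlet.nonneg (hΩ : IsOpen Ω) (hρ : IsTest Ω ρ) (hρ0 : ∀ x, 0 ≤ ρ x)
    (hm : SolvesDirichlet ρ W m) : ∀ᵐ x ∂(volume.restrict Ω), 0 ≤ m x := by
  obtain ⟨G, hp⟩ := hm.1.1.exists_mem
  obtain ⟨n, hn, hn1, hn2⟩ := sobolevGraph_posPart ((sobolevGraph Ω).neg_mem hp)
  have hn1' : n.1 =ᵐ[volume.restrict Ω] fun x => max (-(m x)) 0 := by
    filter_upwards [hn1, Lp.coeFn_neg m] with x e1 e2
    rw [e1, Prod.fst_neg, e2, Pi.neg_apply]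
  have hnW : MemH10On W n.1 := by
    obtain ⟨g, hg, -⟩ := hm.1.2
    exact hm.1.comp₂ hΩ hg (F := fun z => max (-z.1) 0) (by fun_prop) (by simp)
      (memH10_of_mem hn) hn1'
  have h1 := norm_sq_le_energy_posPart hn1 hn2
  rw [energy_neg_left, hm.energy_eq hρ hp hn hnW] at h1
  have h2 : 0 ≤ inner ℝ (hρ.memLp.toLp ρ) n.1 := by
    refine inner_nonneg_of_ae ?_
    filter_upwards [hn1', hρ.memLp.coeFn_toLp] with x e1 e2
    rw [e1, e2]
    exact mul_nonneg (hρ0 x) (le_max_right _ _)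
  have h3 : n.1 = 0 := by
    rw [← norm_eq_zero, ← sq_eq_zero_iff]
    exact le_antisymm (by linarith) (sq_nonneg _)
  rw [h3] at hn1'
  filter_upwards [hn1', Lp.coeFn_zero ℝ 2 ((volume : Measure (Space d)).restrict Ω)] with x e1 e2
  rw [e2, Pi.zero_apply] at e1
  linarith [le_max_left (-(m x)) 0]

/-- The extension by zero of the solution of `-Δm + m = ρ` in `W` satisfies `-Δm + m ≤ ρ` in `Ω`,
tested against `φ ≥ 0` with `-Δφ + φ = A` in `L²(Ω)`. The admissible test function is
`min(m, tφ) = tφ - (tφ - m)⁺`. Since the energy form is nonnegative on `(tφ - m, (tφ - m)⁺)`, it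
gives the inequality up to the error `∫ A (tφ - m)⁺ = O(t)`. -/
lemma SolvesDirichlet.energy_le (hΩ : IsOpen Ω) (hρ : IsTest Ω ρ) (hρ0 : ∀ x, 0 ≤ ρ x)
    {p q : L2 Ω × (Fin d → L2 Ω)} (hp : p ∈ sobolevGraph Ω) (hm : SolvesDirichlet ρ W p.1)
    (hq : q ∈ sobolevGraph Ω) (hq0 : ∀ᵐ x ∂(volume.restrict Ω), 0 ≤ q.1 x) {A : L2 Ω}
    (hA : ∀ r ∈ sobolevGraph Ω, energy q r = inner ℝ A r.1) {h : Space d → ℝ}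
    (hh : IsQuasiContRep h q.1) : energy p q ≤ inner ℝ (hρ.memLp.toLp ρ) q.1 := by
  have key : ∀ t : ℝ, 0 < t →
      energy p q ≤ inner ℝ (hρ.memLp.toLp ρ) q.1 + t * (‖A‖ * ‖q.1‖) := by
    intro t ht
    have hz := (sobolevGraph Ω).sub_mem ((sobolevGraph Ω).smul_mem t hq) hp
    obtain ⟨z, hz', hz1, hz2⟩ := sobolevGraph_posPart hz
    have hzx : z.1 =ᵐ[volume.restrict Ω] fun x => max (t * q.1 x - p.1 x) 0 := by
      filter_upwards [hz1, Lp.coeFn_sub (t • q.1) p.1, Lp.coeFn_smul t q.1] with x e1 e2 e3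
      rw [e1, Prod.fst_sub, Prod.smul_fst, e2, Pi.sub_apply, e3, Pi.smul_apply, smul_eq_mul]
    have hw := (sobolevGraph Ω).sub_mem ((sobolevGraph Ω).smul_mem t hq) hz'
    have hwx : (t • q - z).1 =ᵐ[volume.restrict Ω]
        fun x => min (p.1 x) (t * max (q.1 x) 0) := by
      filter_upwards [hzx, Lp.coeFn_sub (t • q.1) z.1, Lp.coeFn_smul t q.1, hq0] with x e1 e2 e3 e4
      rw [Prod.fst_sub, Prod.smul_fst, e2, Pi.sub_apply, e3, Pi.smul_apply, smul_eq_mul, e1,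
        max_eq_left e4]
      rcases le_total (p.1 x) (t * q.1 x) with hle | hle
      · rw [max_eq_left (by linarith), min_eq_left hle]
        ring
      · rw [max_eq_right (by linarith), min_eq_right hle]
        ring
    have hwW : MemH10On W (t • q - z).1 := by
      refine hm.1.comp₂ hΩ hh (F := fun y => min y.1 (t * max y.2 0)) (by fun_prop) (fun s => ?_)
        (memH10_of_mem hw) hwx
      exact min_eq_left (mul_nonneg ht.le (le_max_right _ _))
    have h1 := hm.energy_eq hρ hp hw hwW
    have h2 : inner ℝ (hρ.memLp.toLp ρ) (t • q - z).1 ≤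
        t * inner ℝ (hρ.memLp.toLp ρ) q.1 := by
      rw [← real_inner_smul_right, ← sub_nonneg, ← inner_sub_right, Prod.fst_sub, Prod.smul_fst,
        sub_sub_cancel]
      refine inner_nonneg_of_ae ?_
      filter_upwards [hzx, hρ.memLp.coeFn_toLp] with x e1 e2
      rw [e1, e2]
      exact mul_nonneg (hρ0 x) (le_max_right _ _)
    have h3 := (sq_nonneg _).trans (norm_sq_le_energy_posPart hz1 hz2)
    rw [energy_sub_left, energy_smul_left, hA z hz'] at h3
    have h4 : ‖z.1‖ ≤ t * ‖q.1‖ := by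
      refine Lp.norm_le_mul_norm_of_ae_le_mul ?_
      filter_upwards [hzx, hq0, hm.nonneg hΩ hρ hρ0] with x e1 e2 e3
      rw [e1, Real.norm_of_nonneg (le_max_right _ _), Real.norm_of_nonneg e2]
      exact max_le (by linarith) (mul_nonneg ht.le e2)
    have h5 : inner ℝ A z.1 ≤ ‖A‖ * (t * ‖q.1‖) :=
      (real_inner_le_norm _ _).trans (mul_le_mul_of_nonneg_left h4 (norm_nonneg _))
    rw [energy_sub_right, energy_smul_right] at h1
    have h6 : t * energy p q ≤
        t * (inner ℝ (hρ.memLp.toLp ρ) q.1 + t * (‖A‖ * ‖q.1‖)) := by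
      have := mul_le_mul_of_nonneg_left h5 ht.le
      linarith
    exact le_of_mul_le_mul_left h6 ht
  have hlim : Tendsto (fun t : ℝ => inner ℝ (hρ.memLp.toLp ρ) q.1 + t * (‖A‖ * ‖q.1‖))
      (𝓝[>] 0) (𝓝 (inner ℝ (hρ.memLp.toLp ρ) q.1 + 0 * (‖A‖ * ‖q.1‖))) :=
    (Continuous.tendsto (by fun_prop) 0).mono_left nhdsWithin_le_nhds
  rw [zero_mul, add_zero] at hlim
  exact ge_of_tendsto hlim (eventually_mem_nhdsWithin.mono fun t ht => key t ht)

end Dirichlet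

/-! ### The obstacle problem and uniqueness -/

section Obstacle

variable {d : ℕ} {Ω : Set (Space d)}

/-- The element `A` is `-Δu + u`; the energy identity is Green's formula. -/
lemma SolvesObstacle.exists_strong (hΩ : IsOpen Ω) {g u : L2 Ω} (h : SolvesObstacle g u) :
    ∃ p ∈ sobolevGraph Ω, ∃ A : L2 Ω, p.1 = u ∧
      (∀ q ∈ sobolevGraph Ω, energy p q = inner ℝ A q.1) ∧
      ∀ᵐ x ∂(volume.restrict Ω), u x ≤ 0 ∧ A x ≤ g x ∧ (u x < 0 → A x = g x) := by
  obtain ⟨hu, G, H, hG, hH, hmax⟩ := h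
  refine ⟨(u, G), hu.mem hΩ hG, u - ∑ i, H i i, rfl, fun q hq => ?_, ?_⟩
  · rw [energy, inner_sub_left, sum_inner, sub_eq_add_neg, ← Finset.sum_neg_distrib]
    simp only [(hH _).inner_gradient hq]
  · filter_upwards [hmax, Lp.coeFn_sub u (∑ i, H i i),
      Lp.coeFn_fun_finsetSum Finset.univ (fun i => H i i)] with x e1 e2 e3
    rw [e2, Pi.sub_apply, e3]
    have h1 := (le_max_left _ _).trans_eq e1
    have h2 := (le_max_right _ _).trans_eq e1
    refine ⟨h2, by linarith, fun hlt => ?_⟩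
    rcases max_choice (-(∑ i, H i i x) + u x - g x) (u x) with hc | hc <;> linarith

/-- Uniqueness in the obstacle problem with a given right-hand side. -/
lemma SolvesObstacle.unique (hΩ : IsOpen Ω) {g u v : L2 Ω} (hu : SolvesObstacle g u)
    (hv : SolvesObstacle g v) : u = v := by
  obtain ⟨p, hp, A, rfl, hpA, hA⟩ := hu.exists_strong hΩ
  obtain ⟨q, hq, B, rfl, hqB, hB⟩ := hv.exists_strong hΩ
  have hpq := (sobolevGraph Ω).sub_mem hp hq
  have h1 := norm_sq_le_energy_self (p - q)
  rw [energy_sub_left, hpA _ hpq, hqB _ hpq, ← inner_sub_left, Prod.fst_sub] at h1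
  have h2 : 0 ≤ inner ℝ (B - A) (p.1 - q.1) := by
    refine inner_nonneg_of_ae ?_
    filter_upwards [hA, hB, Lp.coeFn_sub B A, Lp.coeFn_sub p.1 q.1]
      with x ⟨a1, a2, a3⟩ ⟨b1, b2, b3⟩ e1 e2
    rw [e1, e2, Pi.sub_apply, Pi.sub_apply]
    rcases a1.lt_or_eq with ha | ha <;> rcases b1.lt_or_eq with hb | hb
    · rw [a3 ha, b3 hb, sub_self, zero_mul]
    · exact mul_nonneg_of_nonpos_of_nonpos (by linarith [a3 ha]) (by linarith)
    · exact mul_nonneg (by linarith [b3 hb]) (by linarith)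
    · rw [ha, hb, sub_self, mul_zero]
  rw [← neg_sub A B, inner_neg_left] at h2
  rw [← sub_eq_zero, ← norm_eq_zero, ← sq_eq_zero_iff]
  exact le_antisymm (by linarith) (sq_nonneg _)

/-- Optimality of `m` among the competitors `n`: the density supported where `u < 0` pays the least
for the running cost `g`. -/
lemma inner_sub_nonpos (hΩ : IsOpen Ω) {ρ : Space d → ℝ} (hρ : IsTest Ω ρ) (hρ0 : ∀ x, 0 ≤ ρ x)
    {g u m n : L2 Ω} (hu : SolvesObstacle g u) {u' : Space d → ℝ} (hu' : IsQuasiContRep u' u)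
    (hm : SolvesDirichlet ρ {x ∈ Ω | u' x < 0} m) {W : Set (Space d)}
    (hn : SolvesDirichlet ρ W n) : inner ℝ g (m - n) ≤ 0 := by
  obtain ⟨p, hp, A, rfl, hpA, hA⟩ := hu.exists_strong hΩ
  obtain ⟨Gm, hGm⟩ := hm.1.1.exists_mem
  obtain ⟨Gn, hGn⟩ := hn.1.1.exists_mem
  -- complementarity: `g = A` where `u < 0`; elsewhere `m = 0`, while `g ≥ A` and `n ≥ 0`
  have h1 : 0 ≤ inner ℝ (A - g) (m - n) := by
    refine inner_nonneg_of_ae ?_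
    filter_upwards [hA, hu'.2, hm.1.ae_eq_zero hΩ, hn.nonneg hΩ hρ hρ0, Lp.coeFn_sub A g,
      Lp.coeFn_sub m n] with x ⟨a1, a2, a3⟩ e1 e2 e3 e4 e5
    rw [e4, e5, Pi.sub_apply, Pi.sub_apply]
    rcases a1.lt_or_eq with h | h
    · rw [a3 h, sub_self, zero_mul]
    · rw [e2 fun hW => (hW.2.trans_eq (h.symm.trans e1.symm)).false]
      exact mul_nonneg_of_nonpos_of_nonpos (by linarith) (by linarith)
  -- `min(u', 0)` represents `u` and vanishes everywhere outside `{u' < 0}`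
  have h2 : MemH10On {x ∈ Ω | u' x < 0} p.1 := by
    refine ⟨memH10_of_mem hp, fun x => min (u' x) 0,
      ⟨hu'.1.comp (F := fun s => min s 0) (by fun_prop), ?_⟩, ?_⟩
    · filter_upwards [hu'.2, hA] with x e1 e2
      rw [e1, min_eq_left e2.1]
    · rw [← capacity_empty (Ω := Ω)]
      congr 1
      refine Set.eq_empty_of_forall_notMem ?_
      rintro x ⟨⟨hx, hxW⟩, hne⟩
      exact hne (min_eq_right (not_lt.1 fun hlt => hxW ⟨hx, hlt⟩))
  have h3 := hm.energy_eq hρ hGm hp h2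
  have h4 := hn.energy_le hΩ hρ hρ0 hGn ((sobolevGraph Ω).neg_mem hp) (A := -A)
    (h := fun x => -u' x) ?_ (fun r hr => ?_) ⟨hu'.1.comp continuous_neg, ?_⟩
  · rw [energy_neg_right, Prod.fst_neg, inner_neg_right, energy_comm, hpA _ hGn] at h4
    rw [energy_comm, hpA _ hGm] at h3
    rw [inner_sub_left, inner_sub_right A] at h1
    linarith
  · filter_upwards [hA, Lp.coeFn_neg p.1] with x e1 e2
    rw [Prod.fst_neg, e2, Pi.neg_apply]
    linarith [e1.1]
  · rw [energy_neg_left, hpA r hr, inner_neg_left]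
  · filter_upwards [hu'.2, Lp.coeFn_neg p.1] with x e1 e2
    rw [Prod.fst_neg, e2, Pi.neg_apply, e1]

end Obstacle

end SOSMFG

end

theorem mainTheorem10 (d : ℕ) (hd : 1 ≤ d) (Ω : Set (SOSMFG.Space d))
    (hΩ : IsOpen Ω) (hΩb : Bornology.IsBounded Ω)
    (ρ : SOSMFG.Space d → ℝ) (hρ : SOSMFG.IsTest Ω ρ) (hρ0 : ∀ x, 0 ≤ ρ x)
    (f : SOSMFG.L2 Ω → SOSMFG.L2 Ω) (hf : Continuous f) (hmono : SOSMFG.StrictlyMonotone f)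
    (u₁ m₁ u₂ m₂ : SOSMFG.L2 Ω)
    (h₁ : SOSMFG.IsSolution Ω f ρ u₁ m₁) (h₂ : SOSMFG.IsSolution Ω f ρ u₂ m₂) :
    u₁ = u₂ ∧ m₁ = m₂ := by
  obtain ⟨ho₁, v₁, hv₁, hm₁⟩ := h₁
  obtain ⟨ho₂, v₂, hv₂, hm₂⟩ := h₂
  have hm : m₁ = m₂ := by
    by_contra hne
    have h := hmono m₁ m₂ hne
    have e : inner ℝ (f m₁ - f m₂) (m₁ - m₂) =
        ∫ x in Ω, (f m₁ x - f m₂ x) * (m₁ x - m₂ x) := by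
      rw [SOSMFG.inner_eq_integral]
      refine MeasureTheory.integral_congr_ae ?_
      filter_upwards [MeasureTheory.Lp.coeFn_sub (f m₁) (f m₂),
        MeasureTheory.Lp.coeFn_sub m₁ m₂] with x e1 e2
      rw [e1, e2, Pi.sub_apply, Pi.sub_apply]
    have i1 := SOSMFG.inner_sub_nonpos hΩ hρ hρ0 ho₁ hv₁ hm₁ hm₂
    have i2 := SOSMFG.inner_sub_nonpos hΩ hρ hρ0 ho₂ hv₂ hm₂ hm₁
    rw [← e, inner_sub_left] at h
    rw [← neg_sub, inner_neg_right] at i2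
    linarith
  subst hm
  exact ⟨ho₁.unique hΩ ho₂, rfl⟩
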